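/- **Proposition.** Let $n\ge 2$ and let $q\in\mathbb C$ be a primitive $n$-th root of unity. Let $A=u_q(sl_2)$ be the complex algebra generated by $K,E,F$ with relations $$K^n=1,\quad E^n=F^n=0,\quad EK=qKE,\quad FK=q^{-1}KF,\quad [E,F]=\frac{K-K^{-1}}{q-q^{-1}}$$ (for $n=2$, i.e. $q=-1$, the last relation is read as $[E,F]=0$), with basis $\{K^iF^jE^k\}_{0\le i,j,k<n}$. It is a Hopf algebra with coproduct $$\Delta_H K=K\otimes K,\quad \Delta_H E=1\otimes E+E\otimes K,\quad \Delta_H F=F\otimes 1+K^{-1}\otimes F,$$ counit $\epsilon_H(K)=1$, $\epsilon_H(E)=\epsilon_H(F)=0$, and antipode $SK=K^{-1}$, $SE=-EK^{-1}$, $SF=-KF$. Let $\int:A\to\mathbb C$ be the linear form with $\int KF^{n-1}E^{n-1}=1$ and value $0$ on all other basis monomials, let $\Lambda=\sum_{i=0}^{n-1}K^iF^{n-1}E^{n-1}$, and write $\Delta_H\Lambda=\sum\Lambda_1\otimes\Lambda_2$. Grade $A$ by $\mathbb Z/n\mathbb Z$ through conjugation by $K$, so that $A_d=\{x\in A: KxK^{-1}=q^d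 x\}$; a monomial $K^iF^jE^k$ then has degree $j-k$ modulo $n$. For $x\in A$ let $x_0$ be its component in $A_0=u_q(sl_2)_0$. 1. For every invertible $u\in A$, the bilinear form $(a,b)_u=\int uab$ is a Frobenius form on $A$ with inverse $g_u=\sum\Lambda_1\otimes u^{-1}S\Lambda_2$. That is, for all $a,b,c\in A$ one has $(ab,c)_u=(a,bc)_u$ and, writing $g_u=\sum g^1\otimes g^2$, also $\sum (a,g^1)_u\,g^2=a=\sum g^1\,(g^2,a)_u$. The case $u=1$ is the standard Frobenius structure, and the case of general $u$ is its twist by $u$. 2. The degree-$0$ part $A_0$ is a commutative subalgebra of $A$. 3. The lollipop of the structure twisted by $u$, that is, the image $\sum\Lambda_1u^{-1}S\Lambda_2\in A$ of $g_u$ under the product map $A\otimes A\to A$, depends only on the component $(u^{-1})_0$ of $u^{-1}$ in $A_0$: if $u,v\in A$ are invertible and $(u^{-1})_0=(v^{-1})_0$, then $$\sum\Lambda_1u^{-1}S\Lambda_2=\sum\Lambda_1v^{-1}S\Lambda_2 .$$ -/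

import Mathlib

open scoped TensorProduct

noncomputable section

namespace SmallQuantum

/-! ### The defining relations -/

/-- The relations of `u_q(sl_2)` for elements `k`, `e`, `f` of a complex algebra:
`k ^ n = 1`, `e ^ n = f ^ n = 0`, `e k = q k e`, `f k = q⁻¹ k f` and
`[e, f] = (k - k⁻¹) / (q - q⁻¹)`, where `k⁻¹ = k ^ (n - 1)`.
For `n = 2` (that is `q = -1`, `k⁻¹ = k`) the last relation reads `[e, f] = 0`, which is the usual
convention for the quotient `0 / 0` there, and is what Lean's `0⁻¹ = 0` gives. -/
structure Relations (n : ℕ) (q : ℂ) {B : Type*} [Ring B] [Algebra ℂ B] (k e f : B) : Prop where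
  k_pow : k ^ n = 1
  e_pow : e ^ n = 0
  f_pow : f ^ n = 0
  e_k : e * k = q • (k * e)
  f_k : f * k = q⁻¹ • (k * f)
  e_f : e * f - f * e = (q - q⁻¹)⁻¹ • (k - k ^ (n - 1))

/-- The three generators. -/
inductive Gen : Type
  | K | E | F

/-- The relations imposed on the free algebra on `K`, `E`, `F`. -/
inductive Rel (n : ℕ) (q : ℂ) : FreeAlgebra ℂ Gen → FreeAlgebra ℂ Gen → Prop
  | k_pow : Rel n q (FreeAlgebra.ι ℂ Gen.K ^ n) 1
  | e_pow : Rel n q (FreeAlgebra.ι ℂ Gen.E ^ n) 0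
  | f_pow : Rel n q (FreeAlgebra.ι ℂ Gen.F ^ n) 0
  | e_k : Rel n q (FreeAlgebra.ι ℂ Gen.E * FreeAlgebra.ι ℂ Gen.K)
      (q • (FreeAlgebra.ι ℂ Gen.K * FreeAlgebra.ι ℂ Gen.E))
  | f_k : Rel n q (FreeAlgebra.ι ℂ Gen.F * FreeAlgebra.ι ℂ Gen.K)
      (q⁻¹ • (FreeAlgebra.ι ℂ Gen.K * FreeAlgebra.ι ℂ Gen.F))
  | e_f : Rel n q
      (FreeAlgebra.ι ℂ Gen.E * FreeAlgebra.ι ℂ Gen.F - FreeAlgebra.ι ℂ Gen.F * FreeAlgebra.ι ℂ Gen.E)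
      ((q - q⁻¹)⁻¹ • (FreeAlgebra.ι ℂ Gen.K - FreeAlgebra.ι ℂ Gen.K ^ (n - 1)))

/-- The reduced quantum group `u_q(sl_2)` over `ℂ`, for `q` a primitive `n`-th root of unity,
`2 ≤ n`: the algebra generated by `K`, `E`, `F` with the relations above. -/
def Uq (n : ℕ) (q : ℂ) (_hn : 2 ≤ n) (_hq : IsPrimitiveRoot q n) : Type := RingQuot (Rel n q)

variable {n : ℕ} {q : ℂ} (hn : 2 ≤ n) (hq : IsPrimitiveRoot q n)

instance : Ring (Uq n q hn hq) := inferInstanceAs (Ring (RingQuot (Rel n q)))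

instance : Algebra ℂ (Uq n q hn hq) := inferInstanceAs (Algebra ℂ (RingQuot (Rel n q)))

/-- The quotient map from the free algebra. -/
def mkHom : FreeAlgebra ℂ Gen →ₐ[ℂ] Uq n q hn hq := RingQuot.mkAlgHom ℂ (Rel n q)

def K : Uq n q hn hq := mkHom hn hq (FreeAlgebra.ι ℂ Gen.K)

def E : Uq n q hn hq := mkHom hn hq (FreeAlgebra.ι ℂ Gen.E)

def F : Uq n q hn hq := mkHom hn hq (FreeAlgebra.ι ℂ Gen.F)

theorem relations : Relations n q (K hn hq) (E hn hq) (F hn hq) where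
  k_pow := by
    have h : mkHom hn hq _ = mkHom hn hq _ := RingQuot.mkAlgHom_rel ℂ (Rel.k_pow (n := n) (q := q))
    simpa [K] using h
  e_pow := by
    have h : mkHom hn hq _ = mkHom hn hq _ := RingQuot.mkAlgHom_rel ℂ (Rel.e_pow (n := n) (q := q))
    simpa [E] using h
  f_pow := by
    have h : mkHom hn hq _ = mkHom hn hq _ := RingQuot.mkAlgHom_rel ℂ (Rel.f_pow (n := n) (q := q))
    simpa [F] using h
  e_k := by
    have h : mkHom hn hq _ = mkHom hn hq _ := RingQuot.mkAlgHom_rel ℂ (Rel.e_k (n := n) (q := q))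
    simpa [E, K] using h
  f_k := by
    have h : mkHom hn hq _ = mkHom hn hq _ := RingQuot.mkAlgHom_rel ℂ (Rel.f_k (n := n) (q := q))
    simpa [F, K] using h
  e_f := by
    have h : mkHom hn hq _ = mkHom hn hq _ := RingQuot.mkAlgHom_rel ℂ (Rel.e_f (n := n) (q := q))
    simpa [E, F, K] using h

/-- The universal property: elements satisfying the relations define an algebra map. -/
def lift {B : Type*} [Ring B] [Algebra ℂ B] {k e f : B} (r : Relations n q k e f) :
    Uq n q hn hq →ₐ[ℂ] B :=
  RingQuot.liftAlgHom ℂ (s := Rel n q)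
    ⟨FreeAlgebra.lift ℂ (fun g => match g with | .K => k | .E => e | .F => f), by
      intro x y h
      cases h with
      | k_pow => simpa using r.k_pow
      | e_pow => simpa using r.e_pow
      | f_pow => simpa using r.f_pow
      | e_k => simpa using r.e_k
      | f_k => simpa using r.f_k
      | e_f => simpa using r.e_f⟩

section
variable {B : Type*} [Ring B] [Algebra ℂ B] {k e f : B} (r : Relations n q k e f)

theorem lift_mkHom (x : FreeAlgebra ℂ Gen) : lift hn hq r (mkHom hn hq x) =
    FreeAlgebra.lift ℂ (fun g => match g with | .K => k | .E => e | .F => f) x := by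
  unfold lift mkHom
  exact RingQuot.liftAlgHom_mkAlgHom_apply ..

@[simp] theorem lift_K : lift hn hq r (K hn hq) = k := by simp [K, lift_mkHom]

@[simp] theorem lift_E : lift hn hq r (E hn hq) = e := by simp [E, lift_mkHom]

@[simp] theorem lift_F : lift hn hq r (F hn hq) = f := by simp [F, lift_mkHom]

end

variable {hn hq} in
theorem hom_ext {B : Type*} [Semiring B] [Algebra ℂ B] {φ ψ : Uq n q hn hq →ₐ[ℂ] B}
    (hK : φ (K hn hq) = ψ (K hn hq)) (hE : φ (E hn hq) = ψ (E hn hq))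
    (hF : φ (F hn hq) = ψ (F hn hq)) : φ = ψ := by
  refine RingQuot.ringQuot_ext' ℂ (s := Rel n q) φ ψ ?_
  apply FreeAlgebra.hom_ext
  funext g
  cases g
  · exact hK
  · exact hE
  · exact hF

variable {hn hq} in
/-- Induction over words in the generators. -/
theorem induct {P : Uq n q hn hq → Prop} (h0 : ∀ c : ℂ, P (algebraMap ℂ _ c))
    (hK : P (K hn hq)) (hE : P (E hn hq)) (hF : P (F hn hq))
    (hadd : ∀ x y, P x → P y → P (x + y)) (hmul : ∀ x y, P x → P y → P (x * y))
    (x : Uq n q hn hq) : P x := by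
  obtain ⟨y, rfl⟩ : ∃ y, mkHom hn hq y = x := RingQuot.mkAlgHom_surjective ℂ (Rel n q) x
  induction y using FreeAlgebra.induction with
  | grade0 c => simpa using h0 c
  | grade1 g => cases g <;> assumption
  | mul a b ha hb => simpa using hmul _ _ ha hb
  | add a b ha hb => simpa using hadd _ _ ha hb

/-! ### Commutation lemmas -/

section
variable {B : Type*} [Ring B] [Algebra ℂ B]

theorem pow_skew {x y : B} {s : ℂ} (h : y * x = s • (x * y)) (m : ℕ) :
    y * x ^ m = s ^ m • (x ^ m * y) := by
  induction m with
  | zero => simp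
  | succ m ih =>
    rw [pow_succ, ← mul_assoc, ih, smul_mul_assoc, mul_assoc, h, mul_smul_comm, smul_smul,
      ← pow_succ, mul_assoc]

/-- Gaussian binomial coefficients, indexed by the two parts. -/
def gauss (s : ℂ) : ℕ → ℕ → ℂ
  | 0, _ => 1
  | _ + 1, 0 => 1
  | i + 1, j + 1 => gauss s i (j + 1) + s ^ (i + 1) * gauss s (i + 1) j

theorem gauss_zero_right (s : ℂ) (i : ℕ) : gauss s i 0 = 1 := by
  cases i <;> simp [gauss]

theorem gauss_zero_left (s : ℂ) (i : ℕ) : gauss s 0 i = 1 := by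
  cases i <;> simp [gauss]

theorem gauss_shift (s : ℂ) (i j : ℕ) :
    (1 - s ^ (i + 1)) * gauss s (i + 1) j = (1 - s ^ (j + 1)) * gauss s i (j + 1) := by
  have key : ∀ i j, (1 - s ^ (i + 1)) * gauss s (i + 1) j = (1 - s ^ (i + j + 1)) * gauss s i j ∧
      (1 - s ^ (j + 1)) * gauss s i (j + 1) = (1 - s ^ (i + j + 1)) * gauss s i j := by
    intro i j
    induction hm : i + j using Nat.strong_induction_on generalizing i j with
    | _ m ih =>
      subst hm
      constructor
      · cases j with
        | zero => simp [gauss_zero_right]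
        | succ j =>
          have h1 := (ih (i + j) (by omega) i j rfl)
          rw [gauss]
          have h3 : (1 - s ^ (i + 1)) * gauss s (i + 1) j = (1 - s ^ (j + 1)) * gauss s i (j + 1) :=
            h1.1.trans h1.2.symm
          linear_combination (s ^ (i + 1)) * h3
      · cases i with
        | zero => simp [gauss_zero_left]
        | succ i =>
          have h1 := (ih (i + j) (by omega) i j rfl)
          rw [gauss]
          have h3 : (1 - s ^ (i + 1)) * gauss s (i + 1) j = (1 - s ^ (j + 1)) * gauss s i (j + 1) :=
            h1.1.trans h1.2.symm
          linear_combination -h3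
  exact (key i j).1.trans (key i j).2.symm

theorem gauss_eq_zero {s : ℂ} (hs : IsPrimitiveRoot s n) (i j : ℕ) (h : i + 1 + (j + 1) = n) :
    gauss s (i + 1) (j + 1) = 0 := by
  induction i generalizing j with
  | zero =>
    have h1 := gauss_shift s 0 (j + 1)
    have h2 : s ^ (j + 1 + 1) = 1 := by
      rw [← hs.pow_eq_one]; congr 1; omega
    rw [h2, sub_self, zero_mul] at h1
    rcases mul_eq_zero.1 h1 with h3 | h3
    · exact absurd (sub_eq_zero.1 h3).symm (hs.pow_ne_one_of_pos_of_lt (by omega) (by omega))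
    · exact h3
  | succ i ih =>
    have h1 := gauss_shift s (i + 1) (j + 1)
    rw [ih (j + 1) (by omega), mul_zero] at h1
    rcases mul_eq_zero.1 h1 with h3 | h3
    · exact absurd (sub_eq_zero.1 h3).symm (hs.pow_ne_one_of_pos_of_lt (by omega) (by omega))
    · exact h3

theorem skew_binomial {x y : B} {s : ℂ} (h : y * x = s • (x * y)) (m : ℕ) :
    (x + y) ^ m =
      ∑ p ∈ Finset.HasAntidiagonal.antidiagonal m, gauss s p.1 p.2 • (x ^ p.1 * y ^ p.2) := by
  induction m with
  | zero => simp [gauss]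
  | succ m ih =>
    have hx : ∀ p : ℕ × ℕ, x * gauss s p.1 p.2 • (x ^ p.1 * y ^ p.2) =
        gauss s p.1 p.2 • (x ^ (p.1 + 1) * y ^ p.2) := by
      intro p; rw [mul_smul_comm, ← mul_assoc, ← pow_succ']
    have hy : ∀ p : ℕ × ℕ, y * gauss s p.1 p.2 • (x ^ p.1 * y ^ p.2) =
        (s ^ p.1 * gauss s p.1 p.2) • (x ^ p.1 * y ^ (p.2 + 1)) := by
      intro p
      rw [mul_smul_comm, ← mul_assoc, pow_skew h, smul_mul_assoc, smul_smul, mul_assoc,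
        ← pow_succ', mul_comm]
    let a : ℕ × ℕ → ℂ := fun p => match p with | (0, _) => 0 | (i + 1, j) => gauss s i j
    let b : ℕ × ℕ → ℂ := fun p => match p with | (_, 0) => 0 | (i, j + 1) => s ^ i * gauss s i j
    have hab : ∀ p ∈ Finset.HasAntidiagonal.antidiagonal (m + 1),
        gauss s p.1 p.2 • (x ^ p.1 * y ^ p.2) =
        a p • (x ^ p.1 * y ^ p.2) + b p • (x ^ p.1 * y ^ p.2) := by
      rintro ⟨i, j⟩ hp
      rw [← add_smul]
      congr 1
      rw [Finset.HasAntidiagonal.mem_antidiagonal] at hp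
      rcases i with _ | i <;> rcases j with _ | j <;>
        simp_all [a, b, gauss, gauss_zero_left, gauss_zero_right]
    rw [Finset.sum_congr rfl hab, Finset.sum_add_distrib, Finset.Nat.sum_antidiagonal_succ,
      Finset.Nat.sum_antidiagonal_succ', pow_succ', ih, add_mul, Finset.mul_sum, Finset.mul_sum]
    simp_rw [hx, hy]
    simp [a, b]

theorem skew_pow_eq_zero {x y : B} {s : ℂ} (hs : IsPrimitiveRoot s n) (hn : 2 ≤ n)
    (h : y * x = s • (x * y)) (hx : x ^ n = 0) (hy : y ^ n = 0) : (x + y) ^ n = 0 := by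
  rw [skew_binomial h]
  apply Finset.sum_eq_zero
  rintro ⟨i, j⟩ hp
  rw [Finset.HasAntidiagonal.mem_antidiagonal] at hp
  simp only at hp ⊢
  rcases i with _ | i
  · have : j = n := by omega
    subst this; simp [hy]
  · rcases j with _ | j
    · have : i + 1 = n := by omega
      rw [this]; simp [hx]
    · rw [gauss_eq_zero hs i j hp, zero_smul]

theorem Relations.mul_inv {k e f : B} (r : Relations n q k e f) (hn : 2 ≤ n) :
    k * k ^ (n - 1) = 1 := by
  rw [← pow_succ', Nat.sub_add_cancel (by omega), r.k_pow]

theorem Relations.inv_mul {k e f : B} (r : Relations n q k e f) (hn : 2 ≤ n) :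
    k ^ (n - 1) * k = 1 := by
  rw [← pow_succ, Nat.sub_add_cancel (by omega), r.k_pow]

theorem q_pow_pred (hn : 2 ≤ n) (hq : IsPrimitiveRoot q n) : q ^ (n - 1) = q⁻¹ := by
  apply eq_inv_of_mul_eq_one_left
  rw [← pow_succ, Nat.sub_add_cancel (by omega), hq.pow_eq_one]

theorem Relations.e_inv {k e f : B} (r : Relations n q k e f) (hn : 2 ≤ n)
    (hq : IsPrimitiveRoot q n) : e * k ^ (n - 1) = q⁻¹ • (k ^ (n - 1) * e) := by
  rw [pow_skew r.e_k, q_pow_pred hn hq]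

theorem Relations.f_inv {k e f : B} (r : Relations n q k e f) (hn : 2 ≤ n)
    (hq : IsPrimitiveRoot q n) : f * k ^ (n - 1) = q • (k ^ (n - 1) * f) := by
  rw [pow_skew r.f_k, inv_pow, q_pow_pred hn hq, inv_inv]

theorem pow_mul_of_skew {x y : B} {s : ℂ} (h : x * y = s • (y * x)) (hx : x ^ n = 0) :
    (y * x) ^ n = 0 := by
  have : ∀ m, ∃ c : ℂ, (y * x) ^ m = c • (y ^ m * x ^ m) := by
    intro m
    induction m with
    | zero => exact ⟨1, by simp⟩
    | succ m ih =>
      obtain ⟨c, hc⟩ := ih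
      refine ⟨c * s ^ m, ?_⟩
      have h2 : x * y ^ m = s ^ m • (y ^ m * x) := pow_skew h m
      rw [pow_succ', hc, mul_smul_comm, ← mul_assoc, mul_assoc y x, h2, mul_smul_comm,
        smul_mul_assoc, smul_smul, pow_succ' y, pow_succ' x]
      simp only [mul_assoc]
  obtain ⟨c, hc⟩ := this n
  rw [hc, hx, mul_zero, smul_zero]

end

/-! ### The Hopf algebra structure -/

section
variable {B : Type*} [Ring B] [Algebra ℂ B]

open Algebra.TensorProduct in
theorem Relations.comul {k e f : B} (r : Relations n q k e f) (hn : 2 ≤ n)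
    (hq : IsPrimitiveRoot q n) :
    Relations n q (k ⊗ₜ[ℂ] k) (1 ⊗ₜ[ℂ] e + e ⊗ₜ[ℂ] k) (f ⊗ₜ[ℂ] 1 + (k ^ (n - 1)) ⊗ₜ[ℂ] f) where
  k_pow := by rw [tmul_pow, r.k_pow, one_def]
  e_pow := by
    have hn0 : n ≠ 0 := by omega
    rw [add_comm]
    refine skew_pow_eq_zero hq hn ?_ ?_ ?_
    · rw [tmul_mul_tmul, tmul_mul_tmul, r.e_k, one_mul, mul_one, TensorProduct.tmul_smul]
    · rw [tmul_pow, r.e_pow, TensorProduct.zero_tmul]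
    · rw [tmul_pow, r.e_pow, TensorProduct.tmul_zero]
  f_pow := by
    rw [add_comm]
    refine skew_pow_eq_zero hq hn ?_ ?_ ?_
    · rw [tmul_mul_tmul, tmul_mul_tmul, r.f_inv hn hq, one_mul, mul_one, TensorProduct.smul_tmul']
    · rw [tmul_pow, r.f_pow, TensorProduct.tmul_zero]
    · rw [tmul_pow, r.f_pow, TensorProduct.zero_tmul]
  e_k := by
    simp only [add_mul, mul_add, tmul_mul_tmul, r.e_k, one_mul, mul_one, TensorProduct.tmul_smul,
      smul_add, ← TensorProduct.smul_tmul']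
  f_k := by
    have h : k ^ (n - 1) * k = k * k ^ (n - 1) := (pow_mul_comm' k (n - 1))
    simp only [add_mul, mul_add, tmul_mul_tmul, r.f_k, h, one_mul, mul_one,
      TensorProduct.tmul_smul, smul_add, ← TensorProduct.smul_tmul']
  e_f := by
    have h1 : (1 ⊗ₜ[ℂ] e + e ⊗ₜ[ℂ] k) * (f ⊗ₜ[ℂ] 1 + (k ^ (n - 1)) ⊗ₜ[ℂ] f) -
        (f ⊗ₜ[ℂ] 1 + (k ^ (n - 1)) ⊗ₜ[ℂ] f) * (1 ⊗ₜ[ℂ] e + e ⊗ₜ[ℂ] k) =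
        (k ^ (n - 1)) ⊗ₜ[ℂ] (e * f - f * e) + (e * f - f * e) ⊗ₜ[ℂ] k := by
      simp only [add_mul, mul_add, tmul_mul_tmul, r.f_k, r.e_inv hn hq, one_mul, mul_one,
        TensorProduct.tmul_smul, ← TensorProduct.smul_tmul', TensorProduct.tmul_sub,
        TensorProduct.sub_tmul]
      abel
    rw [h1, r.e_f, tmul_pow]
    simp only [TensorProduct.tmul_smul, ← TensorProduct.smul_tmul', TensorProduct.tmul_sub,
        TensorProduct.sub_tmul, ← smul_add]
    congr 1
    abel

open MulOpposite in
theorem Relations.antipode {k e f : B} (r : Relations n q k e f) (hn : 2 ≤ n)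
    (hq : IsPrimitiveRoot q n) :
    Relations n q (op (k ^ (n - 1))) (op (-(e * k ^ (n - 1)))) (op (-(k * f))) where
  k_pow := by
    rw [← op_pow, ← pow_mul, mul_comm, pow_mul, r.k_pow, one_pow, op_one]
  e_pow := by
    rw [← op_pow, neg_pow, r.e_inv hn hq, smul_pow,
      pow_mul_of_skew (r.e_inv hn hq) r.e_pow]
    simp
  f_pow := by
    rw [← op_pow, neg_pow, pow_mul_of_skew r.f_k r.f_pow]
    simp
  e_k := by
    have h0 : q ≠ 0 := hq.ne_zero (by omega)
    rw [← op_mul, ← op_mul, ← op_smul, r.e_inv hn hq]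
    congr 1
    simp only [mul_neg, neg_mul, smul_neg, mul_smul_comm, smul_mul_assoc, mul_assoc,
      r.e_inv hn hq, smul_smul, mul_inv_cancel_left₀ h0]
  f_k := by
    have h0 : q ≠ 0 := hq.ne_zero (by omega)
    rw [← op_mul, ← op_mul, ← op_smul]
    congr 1
    simp only [mul_neg, neg_mul, smul_neg, mul_assoc, r.f_inv hn hq, mul_smul_comm, smul_smul,
      inv_mul_cancel₀ h0, one_smul]
    rw [← mul_assoc, ← mul_assoc, r.mul_inv hn, r.inv_mul hn]
  e_f := by
    have h0 : q ≠ 0 := hq.ne_zero (by omega)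
    have h1 : k * f * (e * k ^ (n - 1)) = f * e := by
      have : f * k * (e * k ^ (n - 1)) = q⁻¹ • (f * e) := by
        rw [r.e_inv hn hq, mul_smul_comm, mul_assoc, ← mul_assoc k, r.mul_inv hn, one_mul]
      rw [r.f_k, smul_mul_assoc] at this
      exact smul_right_injective B (inv_ne_zero h0) this
    have h2 : e * k ^ (n - 1) * (k * f) = e * f := by
      rw [mul_assoc, ← mul_assoc _ k, r.inv_mul hn, one_mul]
    have h3 : (k ^ (n - 1)) ^ (n - 1) = k := by
      have h4 : (k ^ (n - 1)) ^ (n - 1) * k ^ (n - 1) = 1 := by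
        rw [← pow_succ, Nat.sub_add_cancel (by omega), ← pow_mul, mul_comm, pow_mul, r.k_pow,
          one_pow]
      calc (k ^ (n - 1)) ^ (n - 1) = (k ^ (n - 1)) ^ (n - 1) * (k ^ (n - 1) * k) := by
            rw [r.inv_mul hn, mul_one]
        _ = k := by rw [← mul_assoc, h4, one_mul]
    rw [← op_mul, ← op_mul, ← op_pow, ← op_sub, ← op_sub, ← op_smul, h3]
    congr 1
    rw [neg_mul_neg, neg_mul_neg, h1, h2, ← neg_sub, r.e_f, ← smul_neg, neg_sub]

theorem Relations.counit (hn : 2 ≤ n) : Relations n q (1 : ℂ) 0 0 where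
  k_pow := one_pow n
  e_pow := zero_pow (by omega)
  f_pow := zero_pow (by omega)
  e_k := by simp
  f_k := by simp
  e_f := by simp

end

/-- `Δ K = K ⊗ K`, `Δ E = 1 ⊗ E + E ⊗ K`, `Δ F = F ⊗ 1 + K⁻¹ ⊗ F`. -/
def comulHom : Uq n q hn hq →ₐ[ℂ] Uq n q hn hq ⊗[ℂ] Uq n q hn hq :=
  lift hn hq ((relations hn hq).comul hn hq)

/-- `ε K = 1`, `ε E = ε F = 0`. -/
def counitHom : Uq n q hn hq →ₐ[ℂ] ℂ := lift hn hq (Relations.counit hn)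

/-- The antipode as an algebra map to the opposite algebra:
`S K = K⁻¹`, `S E = - E K⁻¹`, `S F = - K F`. -/
def antipodeHom : Uq n q hn hq →ₐ[ℂ] (Uq n q hn hq)ᵐᵒᵖ :=
  lift hn hq ((relations hn hq).antipode hn hq)

instance : Bialgebra ℂ (Uq n q hn hq) :=
  Bialgebra.ofAlgHom (comulHom hn hq) (counitHom hn hq)
    (by
      apply hom_ext
      · simp [comulHom]
      · simp [comulHom, TensorProduct.add_tmul, TensorProduct.tmul_add, add_assoc,
          Algebra.TensorProduct.one_def]
      · simp [comulHom, TensorProduct.add_tmul, TensorProduct.tmul_add, add_assoc,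
          Algebra.TensorProduct.one_def, Algebra.TensorProduct.tmul_pow])
    (by
      apply hom_ext
      · simp [comulHom, counitHom]
      · simp [comulHom, counitHom]
      · simp [comulHom, counitHom])
    (by
      apply hom_ext
      · simp [comulHom, counitHom]
      · simp [comulHom, counitHom]
      · simp [comulHom, counitHom])

/-- The antipode as a linear map. -/
def antipodeLin : Uq n q hn hq →ₗ[ℂ] Uq n q hn hq :=
  (MulOpposite.opLinearEquiv ℂ).symm.toLinearMap ∘ₗ (antipodeHom hn hq).toLinearMap

theorem antipodeLin_mul (x y : Uq n q hn hq) :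
    antipodeLin hn hq (x * y) = antipodeLin hn hq y * antipodeLin hn hq x := by
  simp [antipodeLin]

theorem antipodeLin_one : antipodeLin hn hq 1 = 1 := by
  simp [antipodeLin]

theorem antipodeLin_K : antipodeLin hn hq (K hn hq) = K hn hq ^ (n - 1) := by
  simp [antipodeLin, antipodeHom]

theorem antipodeLin_E : antipodeLin hn hq (E hn hq) = -(E hn hq * K hn hq ^ (n - 1)) := by
  simp [antipodeLin, antipodeHom]

theorem antipodeLin_F : antipodeLin hn hq (F hn hq) = -(K hn hq * F hn hq) := by
  simp [antipodeLin, antipodeHom]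

theorem comul_eq (x : Uq n q hn hq) : Coalgebra.comul (R := ℂ) x = comulHom hn hq x := rfl

theorem counit_eq (x : Uq n q hn hq) : Coalgebra.counit (R := ℂ) x = counitHom hn hq x := rfl

theorem antipode_left (x : Uq n q hn hq) :
    LinearMap.mul' ℂ _ ((antipodeLin hn hq).rTensor _ (comulHom hn hq x)) =
      algebraMap ℂ _ (counitHom hn hq x) := by
  have key : ∀ t : Uq n q hn hq ⊗[ℂ] Uq n q hn hq, ∀ y z,
      LinearMap.mul' ℂ _ ((antipodeLin hn hq).rTensor _ (t * y ⊗ₜ z)) =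
      antipodeLin hn hq y * LinearMap.mul' ℂ _ ((antipodeLin hn hq).rTensor _ t) * z := by
    intro t y z
    induction t with
    | zero => simp
    | tmul a b => simp [antipodeLin_mul, mul_assoc]
    | add a b ha hb => simp only [add_mul, map_add, ha, hb, mul_add]
  have key2 : ∀ t s : Uq n q hn hq ⊗[ℂ] Uq n q hn hq, ∀ c : ℂ,
      LinearMap.mul' ℂ _ ((antipodeLin hn hq).rTensor _ t) = algebraMap ℂ _ c →
      LinearMap.mul' ℂ _ ((antipodeLin hn hq).rTensor _ (t * s)) =
        algebraMap ℂ _ c * LinearMap.mul' ℂ _ ((antipodeLin hn hq).rTensor _ s) := by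
    intro t s c h
    induction s with
    | zero => simp
    | tmul a b =>
      rw [key, h, ← Algebra.commutes]
      simp [mul_assoc]
    | add a b ha hb => simp only [map_add, ha, hb, mul_add]
  have r := relations hn hq
  induction x using induct with
  | h0 c => simp [antipodeLin_one, Algebra.algebraMap_eq_smul_one, Algebra.TensorProduct.one_def]
  | hK => simp [comulHom, counitHom, antipodeLin_K, r.inv_mul hn]
  | hE =>
    simp [comulHom, counitHom, antipodeLin_E, antipodeLin_one, mul_assoc, r.inv_mul hn]
  | hF =>
    have h : antipodeLin hn hq (K hn hq ^ (n - 1)) = K hn hq := by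
      have h1 : antipodeLin hn hq (K hn hq ^ (n - 1)) * antipodeLin hn hq (K hn hq) = 1 := by
        rw [← antipodeLin_mul, r.mul_inv hn, antipodeLin_one]
      rw [antipodeLin_K] at h1
      calc _ = antipodeLin hn hq (K hn hq ^ (n - 1)) * (K hn hq ^ (n - 1) * K hn hq) := by
            rw [r.inv_mul hn, mul_one]
        _ = _ := by rw [← mul_assoc, h1, one_mul]
    simp [comulHom, counitHom, antipodeLin_F, h]
  | hadd x y hx hy => simp only [map_add, hx, hy]
  | hmul x y hx hy => rw [map_mul, key2 _ _ _ hx, hy, map_mul, map_mul]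

theorem antipode_right (x : Uq n q hn hq) :
    LinearMap.mul' ℂ _ ((antipodeLin hn hq).lTensor _ (comulHom hn hq x)) =
      algebraMap ℂ _ (counitHom hn hq x) := by
  have key : ∀ t : Uq n q hn hq ⊗[ℂ] Uq n q hn hq, ∀ y z,
      LinearMap.mul' ℂ _ ((antipodeLin hn hq).lTensor _ (y ⊗ₜ z * t)) =
      y * LinearMap.mul' ℂ _ ((antipodeLin hn hq).lTensor _ t) * antipodeLin hn hq z := by
    intro t y z
    induction t with
    | zero => simp
    | tmul a b => simp [antipodeLin_mul, mul_assoc]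
    | add a b ha hb => simp only [add_mul, map_add, ha, hb, mul_add]
  have key2 : ∀ t s : Uq n q hn hq ⊗[ℂ] Uq n q hn hq, ∀ c : ℂ,
      LinearMap.mul' ℂ _ ((antipodeLin hn hq).lTensor _ t) = algebraMap ℂ _ c →
      LinearMap.mul' ℂ _ ((antipodeLin hn hq).lTensor _ (s * t)) =
        LinearMap.mul' ℂ _ ((antipodeLin hn hq).lTensor _ s) * algebraMap ℂ _ c := by
    intro t s c h
    induction s with
    | zero => simp
    | tmul a b =>
      rw [key, h, mul_assoc, Algebra.commutes]
      simp [mul_assoc]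
    | add a b ha hb => simp only [map_add, ha, hb, add_mul]
  have r := relations hn hq
  induction x using induct with
  | h0 c => simp [antipodeLin_one, Algebra.algebraMap_eq_smul_one, Algebra.TensorProduct.one_def]
  | hK => simp [comulHom, counitHom, antipodeLin_K, r.mul_inv hn]
  | hE =>
    simp [comulHom, counitHom, antipodeLin_E, antipodeLin_K]
  | hF =>
    simp [comulHom, counitHom, antipodeLin_F, antipodeLin_one, ← mul_assoc, r.inv_mul hn]
  | hadd x y hx hy => simp only [map_add, hx, hy]
  | hmul x y hx hy => rw [map_mul, key2 _ _ _ hy, hx, map_mul, map_mul]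

instance : HopfAlgebra ℂ (Uq n q hn hq) where
  antipode := antipodeLin hn hq
  mul_antipode_rTensor_comul := LinearMap.ext (antipode_left hn hq)
  mul_antipode_lTensor_comul := LinearMap.ext (antipode_right hn hq)

/-! ### The monomial basis -/

theorem Relations.e_pow_f {B : Type*} [Ring B] [Algebra ℂ B] {k e f : B}
    (hek : e * k = q • (k * e)) (hek' : e * k ^ (n - 1) = q⁻¹ • (k ^ (n - 1) * e))
    (hef : e * f - f * e = (q - q⁻¹)⁻¹ • (k - k ^ (n - 1))) (m : ℕ) :
    e ^ (m + 1) * f = f * e ^ (m + 1) + ((q - q⁻¹)⁻¹) •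
      (((∑ t ∈ Finset.range (m + 1), q ^ t) • k -
        (∑ t ∈ Finset.range (m + 1), q⁻¹ ^ t) • k ^ (n - 1)) * e ^ m) := by
  have hef' : e * f = f * e + (q - q⁻¹)⁻¹ • (k - k ^ (n - 1)) := by rw [← hef]; abel
  induction m with
  | zero => simp [hef']
  | succ m ih =>
    rw [pow_succ' e (m + 1), mul_assoc, ih, mul_add, ← mul_assoc, hef', mul_smul_comm, ← mul_assoc,
      mul_sub, mul_smul_comm, mul_smul_comm, hek, hek', add_mul, mul_assoc f, ← pow_succ',
      add_assoc, smul_mul_assoc, ← smul_add]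
    congr 2
    rw [Finset.sum_range_succ' _ (m + 1), Finset.sum_range_succ' _ (m + 1)]
    simp only [pow_succ', ← Finset.mul_sum, pow_zero, add_smul, one_smul, sub_mul, smul_mul_assoc,
      mul_assoc, add_mul, smul_smul, mul_comm]
    abel_nf

/-- The index set of the monomials `K ^ i F ^ j E ^ k`, `0 ≤ i, j, k < n`. -/
abbrev Idx (n : ℕ) : Type := Fin n × Fin n × Fin n

/-- The monomial `K ^ i F ^ j E ^ k`. -/
def monomial (p : Idx n) : Uq n q hn hq :=
  K hn hq ^ (p.1 : ℕ) * F hn hq ^ (p.2.1 : ℕ) * E hn hq ^ (p.2.2 : ℕ)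

/-- The model space for the left regular representation. -/
abbrev Model (n : ℕ) : Type := (ZMod n × Fin n × Fin n) →₀ ℂ

/-- The vector standing for `K ^ i F ^ j E ^ k`. -/
def vec (i : ZMod n) (j k : ℕ) : Model n :=
  if h : j < n ∧ k < n then Finsupp.single (i, ⟨j, h.1⟩, ⟨k, h.2⟩) 1 else 0

theorem vec_of_le_left (i : ZMod n) {j : ℕ} (k : ℕ) (h : n ≤ j) : vec i j k = 0 :=
  dif_neg (by omega)

theorem vec_of_le_right (i : ZMod n) (j : ℕ) {k : ℕ} (h : n ≤ k) : vec i j k = 0 :=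
  dif_neg (by omega)

/-- `q ^ i` for `i` modulo `n`. -/
def qz (n : ℕ) (q : ℂ) (i : ZMod n) : ℂ := q ^ i.val

theorem qz_natCast (hn : 2 ≤ n) (hq : IsPrimitiveRoot q n) (m : ℕ) :
    qz n q (m : ZMod n) = q ^ m := by
  have : NeZero n := ⟨by omega⟩
  rw [qz, ZMod.val_natCast, hq.eq_orderOf, pow_mod_orderOf]

theorem qz_add (hn : 2 ≤ n) (hq : IsPrimitiveRoot q n) (i j : ZMod n) :
    qz n q (i + j) = qz n q i * qz n q j := by
  have : NeZero n := ⟨by omega⟩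
  rw [← ZMod.natCast_zmod_val i, ← ZMod.natCast_zmod_val j, ← Nat.cast_add, qz_natCast hn hq,
    qz_natCast hn hq, qz_natCast hn hq, pow_add]

theorem qz_one (hn : 2 ≤ n) (hq : IsPrimitiveRoot q n) : qz n q 1 = q := by
  simpa using qz_natCast hn hq 1

theorem qz_zero (hn : 2 ≤ n) (hq : IsPrimitiveRoot q n) : qz n q 0 = 1 := by
  simpa using qz_natCast hn hq 0

theorem qz_neg (hn : 2 ≤ n) (hq : IsPrimitiveRoot q n) (i : ZMod n) :
    qz n q (-i) = (qz n q i)⁻¹ := by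
  apply eq_inv_of_mul_eq_one_left
  rw [← qz_add hn hq, neg_add_cancel, qz_zero hn hq]

theorem qz_injective (hn : 2 ≤ n) (hq : IsPrimitiveRoot q n) : Function.Injective (qz n q) := by
  have : NeZero n := ⟨by omega⟩
  intro i j h
  exact ZMod.val_injective n (hq.pow_inj (ZMod.val_lt i) (ZMod.val_lt j) h)

/-- The operator with prescribed values on the vectors `vec`. -/
def opOf (g : ZMod n → ℕ → ℕ → Model n) : Model n →ₗ[ℂ] Model n :=
  Finsupp.linearCombination ℂ fun p => g p.1 p.2.1 p.2.2

theorem opOf_vec (g : ZMod n → ℕ → ℕ → Model n)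
    (hg : ∀ i j k, ¬(j < n ∧ k < n) → g i j k = 0) (i : ZMod n) (j k : ℕ) :
    opOf g (vec i j k) = g i j k := by
  by_cases h : j < n ∧ k < n
  · simp [vec, h, opOf]
  · rw [vec, dif_neg h, map_zero, hg i j k h]

theorem op_ext {S T : Model n →ₗ[ℂ] Model n}
    (h : ∀ i j k, S (vec i j k) = T (vec i j k)) : S = T := by
  apply Finsupp.lhom_ext'
  rintro ⟨i, j, k⟩
  refine LinearMap.ext_ring ?_
  simpa [vec] using h i j k

def opK (n : ℕ) : Module.End ℂ (Model n) := opOf fun i j k => vec (i + 1) j k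

def opF (n : ℕ) (q : ℂ) : Module.End ℂ (Model n) :=
  opOf fun i j k => (qz n q i)⁻¹ • vec i (j + 1) k

def opE (n : ℕ) (q : ℂ) : Module.End ℂ (Model n) :=
  opOf fun i j k => qz n q i • (vec i j (k + 1) + (q - q⁻¹)⁻¹ •
    ((∑ t ∈ Finset.range j, q⁻¹ ^ t) • vec (i + 1) (j - 1) k -
      (∑ t ∈ Finset.range j, q ^ t) • vec (i - 1) (j - 1) k))

theorem opK_vec (i : ZMod n) (j k : ℕ) : opK n (vec i j k) = vec (i + 1) j k :=
  opOf_vec _ (fun _ _ _ h => dif_neg h) i j k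

theorem opF_vec (i : ZMod n) (j k : ℕ) :
    opF n q (vec i j k) = (qz n q i)⁻¹ • vec i (j + 1) k :=
  opOf_vec _ (fun i j k h => by rw [vec, dif_neg (by omega), smul_zero]) i j k

theorem opE_vec (hn : 2 ≤ n) (hq : IsPrimitiveRoot q n) (i : ZMod n) (j k : ℕ) :
    opE n q (vec i j k) = qz n q i • (vec i j (k + 1) + (q - q⁻¹)⁻¹ •
    ((∑ t ∈ Finset.range j, q⁻¹ ^ t) • vec (i + 1) (j - 1) k -
      (∑ t ∈ Finset.range j, q ^ t) • vec (i - 1) (j - 1) k)) := by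
  refine opOf_vec _ (fun i j k h => ?_) i j k
  rw [vec, dif_neg (by omega), zero_add]
  by_cases hk : n ≤ k
  · simp [vec_of_le_right _ _ hk]
  · rcases eq_or_ne j n with rfl | hj
    · rw [hq.geom_sum_eq_zero (by omega), hq.inv.geom_sum_eq_zero (by omega)]
      simp
    · rw [vec_of_le_left _ _ (by omega), vec_of_le_left _ _ (by omega)]
      simp

theorem opK_pow_vec (m : ℕ) (i : ZMod n) (j k : ℕ) :
    (opK n ^ m) (vec i j k) = vec (i + (m : ZMod n)) j k := by
  induction m with
  | zero => simp
  | succ m ih => rw [pow_succ', Module.End.mul_apply, ih, opK_vec]; push_cast; rw [add_assoc]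

theorem opF_pow_vec (m : ℕ) (i : ZMod n) (j k : ℕ) :
    (opF n q ^ m) (vec i j k) = ((qz n q i)⁻¹) ^ m • vec i (j + m) k := by
  induction m with
  | zero => simp
  | succ m ih =>
    rw [pow_succ', Module.End.mul_apply, ih, map_smul, opF_vec, smul_smul, ← pow_succ, add_assoc]

theorem opE_pow_vec (hn : 2 ≤ n) (hq : IsPrimitiveRoot q n) (m : ℕ) (k : ℕ) :
    (opE n q ^ m) (vec 0 0 k) = vec 0 0 (k + m) := by
  induction m with
  | zero => simp
  | succ m ih =>
    rw [pow_succ', Module.End.mul_apply, ih, opE_vec hn hq]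
    simp [qz_zero hn hq, add_assoc]

theorem op_relations (hn : 2 ≤ n) (hq : IsPrimitiveRoot q n) :
    Relations n q (opK n) (opE n q) (opF n q) := by
  have h0 : q ≠ 0 := hq.ne_zero (by omega)
  have hz : ∀ i, qz n q i ≠ 0 := fun i => pow_ne_zero _ h0
  have hk : opK n ^ n = 1 := op_ext fun i j k => by simp [opK_pow_vec]
  have hkinv : ∀ i j k, (opK n ^ (n - 1)) (vec i j k) = vec (i - 1) j k := by
    intro i j k
    rw [opK_pow_vec, Nat.cast_sub (by omega)]
    simp [sub_eq_add_neg]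
  have hek : opE n q * opK n = q • (opK n * opE n q) := op_ext fun i j k => by
    simp only [Module.End.mul_apply, LinearMap.smul_apply, opK_vec, opE_vec hn hq, map_smul,
      map_add, map_sub, qz_add hn hq, qz_one hn hq, smul_smul, mul_comm q]
    congr 5
    · abel_nf
  have hef : opE n q * opF n q - opF n q * opE n q =
      (q - q⁻¹)⁻¹ • (opK n - opK n ^ (n - 1)) := op_ext fun i j k => by
    simp only [Module.End.mul_apply, LinearMap.smul_apply, LinearMap.sub_apply, opK_vec, hkinv,
      opE_vec hn hq, opF_vec, map_smul, map_add, map_sub, sub_eq_add_neg i, qz_add hn hq,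
      qz_one hn hq, qz_neg hn hq, Nat.add_sub_cancel]
    rcases j with _ | j
    · simp [smul_smul, hz i]
    · rw [Finset.sum_range_succ' _ (j + 1), Finset.sum_range_succ' _ (j + 1)]
      simp only [pow_succ' _ (_ : ℕ), ← Finset.mul_sum, Nat.succ_sub_one, pow_zero]
      have := hz i
      match_scalars <;> field_simp <;> ring
  refine ⟨hk, ?_, ?_, hek, ?_, hef⟩
  · have hK : ∀ i j k, vec i j k = (opK n ^ i.val) (vec 0 j k) := by
      intro i j k
      have : NeZero n := ⟨by omega⟩
      rw [opK_pow_vec]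
      simp
    have hF : ∀ j k, vec 0 j k = (opF n q ^ j) (vec (0 : ZMod n) 0 k) := by
      intro j k
      rw [opF_pow_vec]
      simp [qz_zero hn hq]
    have hek' : opE n q * opK n ^ (n - 1) = q⁻¹ • (opK n ^ (n - 1) * opE n q) := by
      rw [pow_skew (B := Module.End ℂ (Model n)) hek, q_pow_pred hn hq]
    have hfE : opE n q ^ n * opF n q = opF n q * opE n q ^ n := by
      obtain ⟨m, rfl⟩ : ∃ m, n = m + 1 := ⟨n - 1, by omega⟩
      rw [Relations.e_pow_f (B := Module.End ℂ (Model (m + 1))) hek hek' hef,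
        hq.geom_sum_eq_zero (by omega),
        hq.inv.geom_sum_eq_zero (by omega)]
      simp
    have hkE : ∀ m, opE n q ^ m * opK n = q ^ m • (opK n * opE n q ^ m) := by
      intro m
      induction m with
      | zero => simp
      | succ m ih =>
        rw [pow_succ, mul_assoc, hek, mul_smul_comm, ← mul_assoc, ih, smul_mul_assoc, smul_smul,
          mul_assoc, ← pow_succ, ← pow_succ']
    have hkE' : Commute (opE n q ^ n) (opK n) := by
      have := hkE n
      rwa [hq.pow_eq_one, one_smul] at this
    have hfE' : Commute (opE n q ^ n) (opF n q) := hfE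
    apply op_ext
    intro i j k
    rw [hK, hF, ← Module.End.mul_apply (opE n q ^ n) (opK n ^ i.val), (hkE'.pow_right _).eq,
      Module.End.mul_apply, ← Module.End.mul_apply (opE n q ^ n) (opF n q ^ j),
      (hfE'.pow_right _).eq, Module.End.mul_apply, opE_pow_vec hn hq,
      vec_of_le_right _ _ (by omega)]
    simp
  · apply op_ext
    intro i j k
    rw [opF_pow_vec, vec_of_le_left _ _ (by omega)]
    simp
  · apply op_ext
    intro i j k
    simp only [Module.End.mul_apply, LinearMap.smul_apply, opK_vec, opF_vec, map_smul,
      qz_add hn hq, qz_one hn hq, mul_inv, smul_smul, mul_comm]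

/-- The action on the model space. -/
def act : Uq n q hn hq →ₐ[ℂ] Module.End ℂ (Model n) := lift hn hq (op_relations hn hq)

theorem act_monomial (p : Idx n) :
    act hn hq (monomial hn hq p) (vec 0 0 0) = vec (p.1 : ℕ) p.2.1 p.2.2 := by
  simp only [monomial, act, map_mul, map_pow, lift_K, lift_E, lift_F, Module.End.mul_apply,
    opE_pow_vec hn hq, opF_pow_vec, map_smul, opK_pow_vec]
  simp [qz_zero hn hq]

theorem monomial_linearIndependent : LinearIndependent ℂ (monomial hn hq) := by
  have : NeZero n := ⟨by omega⟩
  apply LinearIndependent.of_comp ((LinearMap.applyₗ (vec (0 : ZMod n) 0 0)) ∘ₗ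
    (act hn hq).toLinearMap)
  have h : (((LinearMap.applyₗ (vec (0 : ZMod n) 0 0)) ∘ₗ (act hn hq).toLinearMap) ∘
      monomial hn hq) = (fun a => Finsupp.single a (1 : ℂ)) ∘
        fun p : Idx n => (((p.1 : ℕ) : ZMod n), p.2) := by
    funext p
    simp only [Function.comp_apply, LinearMap.comp_apply, AlgHom.toLinearMap_apply,
      LinearMap.applyₗ_apply_apply, act_monomial]
    simp [vec]
  rw [h]
  refine LinearIndependent.comp ?_ _ ?_
  · exact Finsupp.linearIndependent_single_one ℂ _
  · rintro ⟨i, p⟩ ⟨i', p'⟩ h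
    simp only [Prod.mk.injEq] at h
    obtain ⟨h1, rfl⟩ := h
    congr 1
    rw [ZMod.natCast_eq_natCast_iff', Nat.mod_eq_of_lt i.2, Nat.mod_eq_of_lt i'.2] at h1
    exact Fin.ext h1

theorem monomial_span : ⊤ ≤ Submodule.span ℂ (Set.range (monomial hn hq)) := by
  have r := relations hn hq
  set M := Submodule.span ℂ (Set.range (monomial hn hq)) with hM
  have hmem : ∀ i j k : ℕ, K hn hq ^ i * F hn hq ^ j * E hn hq ^ k ∈ M := by
    intro i j k
    by_cases hj : n ≤ j
    · rw [pow_eq_zero_of_le hj r.f_pow]; simp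
    by_cases hk : n ≤ k
    · rw [pow_eq_zero_of_le hk r.e_pow]; simp
    rw [← Nat.div_add_mod i n, pow_add, pow_mul, r.k_pow, one_pow, one_mul]
    exact Submodule.subset_span ⟨(⟨i % n, Nat.mod_lt _ (by omega)⟩, ⟨j, by omega⟩, ⟨k, by omega⟩),
      rfl⟩
  have hind : ∀ a : Uq n q hn hq, (∀ i j k : ℕ, a * (K hn hq ^ i * F hn hq ^ j * E hn hq ^ k) ∈ M) →
      ∀ x ∈ M, a * x ∈ M := by
    intro a ha x hx
    induction hx using Submodule.span_induction with
    | mem x hx => obtain ⟨p, rfl⟩ := hx; exact ha _ _ _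
    | zero => simp
    | add x y _ _ hx hy => rw [mul_add]; exact M.add_mem hx hy
    | smul c x _ hx => rw [mul_smul_comm]; exact M.smul_mem _ hx
  have hK : ∀ x ∈ M, K hn hq * x ∈ M := hind _ fun i j k => by
    rw [← mul_assoc, ← mul_assoc, ← pow_succ']; exact hmem _ _ _
  have hKp : ∀ m : ℕ, ∀ x ∈ M, K hn hq ^ m * x ∈ M := by
    intro m
    induction m with
    | zero => simp
    | succ m ih => intro x hx; rw [pow_succ', mul_assoc]; exact hK _ (ih x hx)
  have hF : ∀ x ∈ M, F hn hq * x ∈ M := hind _ fun i j k => by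
    rw [← mul_assoc, ← mul_assoc, pow_skew r.f_k, smul_mul_assoc, smul_mul_assoc, mul_assoc _ (F hn hq),
      ← pow_succ']
    exact M.smul_mem _ (hmem _ _ _)
  have hE0 : ∀ j k : ℕ, E hn hq * (F hn hq ^ j * E hn hq ^ k) ∈ M := by
    intro j k
    induction j with
    | zero => simpa [← pow_succ'] using hmem 0 0 (k + 1)
    | succ j ih =>
      have h1 : E hn hq * F hn hq = F hn hq * E hn hq +
          (q - q⁻¹)⁻¹ • (K hn hq - K hn hq ^ (n - 1)) := by rw [← r.e_f]; abel
      rw [pow_succ', mul_assoc (F hn hq), ← mul_assoc (E hn hq), h1, add_mul, mul_assoc (F hn hq),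
        smul_mul_assoc, sub_mul]
      have h2 : F hn hq ^ j * E hn hq ^ k ∈ M := by simpa using hmem 0 j k
      exact M.add_mem (hF _ ih) (M.smul_mem _ (M.sub_mem (hK _ h2) (hKp _ _ h2)))
  have hE : ∀ x ∈ M, E hn hq * x ∈ M := hind _ fun i j k => by
    rw [mul_assoc (K hn hq ^ i), ← mul_assoc, pow_skew r.e_k, smul_mul_assoc, mul_assoc]
    exact M.smul_mem _ (hKp _ _ (hE0 j k))
  have hall : ∀ a : Uq n q hn hq, ∀ x ∈ M, a * x ∈ M := by
    intro a
    induction a using induct with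
    | h0 c => intro x hx; rw [← Algebra.smul_def]; exact M.smul_mem _ hx
    | hK => exact hK
    | hE => exact hE
    | hF => exact hF
    | hadd a b ha hb => intro x hx; rw [add_mul]; exact M.add_mem (ha x hx) (hb x hx)
    | hmul a b ha hb => intro x hx; rw [mul_assoc]; exact ha _ (hb x hx)
  intro a _
  simpa using hall a 1 (by simpa using hmem 0 0 0)

/-- The monomial basis `K ^ i F ^ j E ^ k`. -/
def monomialBasis : Module.Basis (Idx n) ℂ (Uq n q hn hq) :=
  Module.Basis.mk (monomial_linearIndependent hn hq) (monomial_span hn hq)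

theorem monomialBasis_apply (p : Idx n) : monomialBasis hn hq p = monomial hn hq p := by
  simp [monomialBasis]

/-! ### The integral and the standard Frobenius structure -/

/-- The integral: `∫ K F ^ (n - 1) E ^ (n - 1) = 1`, and `∫` is zero on the other basis monomials. -/
def integral : Uq n q hn hq →ₗ[ℂ] ℂ :=
  (monomialBasis hn hq).coord (⟨1, by omega⟩, ⟨n - 1, by omega⟩, ⟨n - 1, by omega⟩)

theorem integral_monomial (p : Idx n) : integral hn hq (monomial hn hq p) =
    if (p.1 : ℕ) = 1 ∧ (p.2.1 : ℕ) = n - 1 ∧ (p.2.2 : ℕ) = n - 1 then 1 else 0 := by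
  rw [← monomialBasis_apply, integral, Module.Basis.coord_apply, Module.Basis.repr_self,
    Finsupp.single_apply]
  simp [Prod.ext_iff, Fin.ext_iff]

/-- The integral of the dual, `Λ = ∑_{i < n} K ^ i F ^ (n - 1) E ^ (n - 1)`. -/
def Lam : Uq n q hn hq :=
  ∑ i ∈ Finset.range n, K hn hq ^ i * F hn hq ^ (n - 1) * E hn hq ^ (n - 1)

section
variable {A : Type*} [Ring A] [Algebra ℂ A]

/-- `β` is a Frobenius bilinear form on `A` with inverse `g = ∑ g¹ ⊗ g²`: one has
`β(ab, c) = β(a, bc)`, `∑ β(a, g¹) g² = a` and `∑ g¹ β(g², a) = a`. -/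
structure IsFrobenius (β : A →ₗ[ℂ] A →ₗ[ℂ] ℂ) (g : A ⊗[ℂ] A) : Prop where
  assoc : ∀ a b c, β (a * b) c = β a (b * c)
  left : ∀ a, TensorProduct.lid ℂ A ((β a).rTensor A g) = a
  right : ∀ a, TensorProduct.rid ℂ A ((β.flip a).lTensor A g) = a

/-- The twisted form `(a, b)_u = (u a, b)`. -/
def twistForm (β : A →ₗ[ℂ] A →ₗ[ℂ] ℂ) (u : Aˣ) : A →ₗ[ℂ] A →ₗ[ℂ] ℂ :=
  β ∘ₗ LinearMap.mulLeft ℂ (u : A)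

/-- The twisted inverse `g_u = ∑ g¹ ⊗ u⁻¹ g²`. -/
def twistInverse (g : A ⊗[ℂ] A) (u : Aˣ) : A ⊗[ℂ] A :=
  (LinearMap.mulLeft ℂ (↑u⁻¹ : A)).lTensor A g

/-- The lollipop `μ(g) = ∑ g¹ g²`. -/
def lollipop (g : A ⊗[ℂ] A) : A := LinearMap.mul' ℂ A g

end

/-- The standard form `(a, b) = ∫ a b`. -/
def standardForm : Uq n q hn hq →ₗ[ℂ] Uq n q hn hq →ₗ[ℂ] ℂ :=
  (LinearMap.mul ℂ (Uq n q hn hq)).compr₂ (integral hn hq)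

/-- The inverse `g = ∑ Λ₁ ⊗ S Λ₂` of the standard form. -/
def standardInverse : Uq n q hn hq ⊗[ℂ] Uq n q hn hq :=
  (HopfAlgebra.antipode ℂ (A := Uq n q hn hq)).lTensor _ (Coalgebra.comul (R := ℂ) (Lam hn hq))

/-- The lollipop `∑ Λ₁ u⁻¹ S Λ₂` of the standard Frobenius structure twisted by `u`. -/
def twistedLollipop (u : (Uq n q hn hq)ˣ) : Uq n q hn hq :=
  lollipop (twistInverse (standardInverse hn hq) u)

/-! ### The grading -/

/-- Conjugation `x ↦ K x K⁻¹`. -/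
def conjK : Module.End ℂ (Uq n q hn hq) :=
  LinearMap.mulRight ℂ (K hn hq ^ (n - 1)) ∘ₗ LinearMap.mulLeft ℂ (K hn hq)

/-- The part of degree `d ∈ ℤ/n`: the elements `x` with `K x K⁻¹ = q ^ d x`. -/
def degreePart (d : ZMod n) : Submodule ℂ (Uq n q hn hq) :=
  (conjK hn hq).eigenspace (qz n q d)

theorem conjK_mul (x y : Uq n q hn hq) : conjK hn hq (x * y) = conjK hn hq x * conjK hn hq y := by
  have h := (relations hn hq).inv_mul hn
  simp only [conjK, LinearMap.comp_apply, LinearMap.mulRight_apply, LinearMap.mulLeft_apply]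
  calc _ = K hn hq * x * 1 * (y * K hn hq ^ (n - 1)) := by simp only [mul_assoc, one_mul]
    _ = _ := by rw [← h]; simp only [mul_assoc]

theorem mem_degreePart {d : ZMod n} {x : Uq n q hn hq} :
    x ∈ degreePart hn hq d ↔ K hn hq * x * K hn hq ^ (n - 1) = qz n q d • x :=
  Module.End.mem_eigenspace_iff

instance : SetLike.GradedMonoid (degreePart hn hq) where
  one_mem := by
    rw [mem_degreePart, mul_one, (relations hn hq).mul_inv hn, qz_zero hn hq, one_smul]
  mul_mem := by
    intro i j x y hx hy
    simp only [degreePart, Module.End.mem_eigenspace_iff] at hx hy ⊢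
    rw [conjK_mul, hx, hy, qz_add hn hq, smul_mul_smul_comm]

theorem K_mem : K hn hq ∈ degreePart hn hq 0 := by
  rw [mem_degreePart, mul_assoc, (relations hn hq).mul_inv hn, qz_zero hn hq, mul_one, one_smul]

theorem F_mem : F hn hq ∈ degreePart hn hq 1 := by
  have r := relations hn hq
  rw [mem_degreePart, mul_assoc, r.f_inv hn hq, mul_smul_comm, ← mul_assoc, r.mul_inv hn,
    qz_one hn hq, one_mul]

theorem E_mem : E hn hq ∈ degreePart hn hq (-1) := by
  have r := relations hn hq
  rw [mem_degreePart, mul_assoc, r.e_inv hn hq, mul_smul_comm, ← mul_assoc, r.mul_inv hn,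
    qz_neg hn hq, qz_one hn hq, one_mul]

/-- The degree of a monomial is the number of `F`'s minus the number of `E`'s. -/
theorem monomial_mem (p : Idx n) :
    monomial hn hq p ∈ degreePart hn hq (((p.2.1 : ℕ) : ZMod n) - ((p.2.2 : ℕ) : ZMod n)) := by
  have h := SetLike.mul_mem_graded (SetLike.mul_mem_graded
    (SetLike.pow_mem_graded (p.1 : ℕ) (K_mem hn hq)) (SetLike.pow_mem_graded (p.2.1 : ℕ)
    (F_mem hn hq))) (SetLike.pow_mem_graded (p.2.2 : ℕ) (E_mem hn hq))
  have h2 : (p.1 : ℕ) • (0 : ZMod n) + (p.2.1 : ℕ) • (1 : ZMod n) + (p.2.2 : ℕ) • (-1 : ZMod n) =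
      ((p.2.1 : ℕ) : ZMod n) - ((p.2.2 : ℕ) : ZMod n) := by
    simp [sub_eq_add_neg]
  rw [h2] at h
  exact h

theorem degreePart_isInternal : DirectSum.IsInternal (degreePart hn hq) := by
  apply DirectSum.isInternal_submodule_of_iSupIndep_of_iSup_eq_top
  · exact (conjK hn hq).eigenspaces_iSupIndep.comp (qz_injective hn hq)
  · rw [eq_top_iff]
    refine (monomial_span hn hq).trans (Submodule.span_le.2 ?_)
    rintro _ ⟨p, rfl⟩
    exact Submodule.mem_iSup_of_mem _ (monomial_mem hn hq p)

/-- The `ℤ/n`-grading of `u_q(sl_2)`. -/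
instance : GradedAlgebra (degreePart hn hq) where
  __ := (degreePart_isInternal hn hq).chooseDecomposition

end SmallQuantum

end

open SmallQuantum

noncomputable section

namespace SmallQuantum

/-! The element `Λ` is a left integral: `EΛ = FΛ = 0` and `KΛ = Λ`. Since `Φ = (id ⊗ S)Δ` is an
algebra map into `A ⊗ Aᵒᵖ`, these three equations yield the Casimir identity `∑ aΛ₁ ⊗ SΛ₂ = ∑ Λ₁ ⊗
SΛ₂a`, checked on generators and extended to products (`tmul_one_mul_casimir`). A q-binomial
computation gives `∑ ∫Λ₁ · Λ₂ = 1` (`integral_comul_Lam`). Together, `∑ ∫(uaΛ₁) u⁻¹SΛ₂ = u⁻¹ (∑ ∫Λ₁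
· SΛ₂) ua = a`, which is one half of the inverse property. The other half is automatic in finite
dimension (`IsFrobenius.of_left`).

A basis monomial has degree 0 exactly when its exponents of `F` and `E` agree. Such a monomial is a
polynomial in the commuting elements `K` and `FE`, so `A₀` is commutative
(`degreePart_zero_le_cartan`).

The lollipop is the value at `w = u⁻¹` of the linear map `w ↦ ∑ Λ₁ w SΛ₂`. As `ΛK = Λ`, this map
takes the same value at `w` and at `KwK⁻¹` (`adLam_conjK`). It therefore kills every `A_d` with `d ≠
0`, where conjugation is the scalar `q ^ d ≠ 1`, and sees only the degree-0 component.

Below, `(q - q⁻¹)⁻¹` is only ever a coefficient, so its value 0 for `n = 2` needs no separate case.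
-/

/-! ### Relations behind the left integral -/

theorem geom_sum_mul_self {A : Type*} [Ring A] {n : ℕ} {x : A} (h : x ^ n = 1) :
    (∑ i ∈ Finset.range n, x ^ i) * x = ∑ i ∈ Finset.range n, x ^ i := by
  have := geom_sum_mul x n
  rwa [h, sub_self, mul_sub, mul_one, sub_eq_zero] at this

section
variable {A : Type*} [Ring A] [Algebra ℂ A]

theorem geom_sum_pred {n : ℕ} {s : ℂ} (hn : 2 ≤ n) (hs : IsPrimitiveRoot s n) :
    ∑ t ∈ Finset.range (n - 1), s ^ t = -s⁻¹ := by
  have h := hs.geom_sum_eq_zero (by omega)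
  obtain ⟨m, rfl⟩ : ∃ m, n = m + 1 := ⟨n - 1, by omega⟩
  rw [Finset.sum_range_succ] at h
  rw [← q_pow_pred hn hs]
  exact eq_neg_of_add_eq_zero_left h

theorem Relations.inv_pow_pred {n : ℕ} {q : ℂ} {k e f : A} (r : Relations n q k e f)
    (hn : 2 ≤ n) : (k ^ (n - 1)) ^ (n - 1) = k := by
  have h4 : (k ^ (n - 1)) ^ (n - 1) * k ^ (n - 1) = 1 := by
    rw [← pow_succ, Nat.sub_add_cancel (by omega), ← pow_mul, mul_comm, pow_mul, r.k_pow, one_pow]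
  calc (k ^ (n - 1)) ^ (n - 1) = (k ^ (n - 1)) ^ (n - 1) * (k ^ (n - 1) * k) := by
        rw [r.inv_mul hn, mul_one]
    _ = k := by rw [← mul_assoc, h4, one_mul]

/-- The relations are symmetric under exchanging `e` with `f` and `k` with `k⁻¹`, so this is
`Relations.e_pow_f` read through that exchange. The geometric sums have one term fewer than a
vanishing full sum, which leaves `-q⁻¹` and `-q`. -/
theorem Relations.e_f_pow_pred {n : ℕ} {q : ℂ} {k e f : A} (r : Relations n q k e f)
    (hn : 2 ≤ n) (hq : IsPrimitiveRoot q n) :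
    e * f ^ (n - 1) = f ^ (n - 1) * e +
      (q - q⁻¹)⁻¹ • ((q⁻¹ • k ^ (n - 1) - q • k) * f ^ (n - 2)) := by
  have h := Relations.e_pow_f (n := n) (q := q) (e := f) (f := e) (k := k ^ (n - 1))
    (r.f_inv hn hq) (by rw [r.inv_pow_pred hn, r.f_k])
    (by rw [r.inv_pow_pred hn, ← neg_sub, r.e_f, ← smul_neg, neg_sub]) (n - 2)
  rw [show n - 2 + 1 = n - 1 by omega, geom_sum_pred hn hq, geom_sum_pred hn hq.inv, inv_inv,
    r.inv_pow_pred hn] at h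
  rw [h, add_assoc, ← smul_add, ← add_mul]
  simp

/-- Moving `e` past the sum of the `k ^ i` turns that sum into `z`, which absorbs `q k` and `q⁻¹
k⁻¹` alike. Hence `z` kills the commutator of `e` with `f ^ (n - 1)`, and the remaining term
contains `e ^ n = 0`. -/
theorem Relations.e_mul_integral {n : ℕ} {q : ℂ} {k e f : A} (r : Relations n q k e f)
    (hn : 2 ≤ n) (hq : IsPrimitiveRoot q n) :
    e * ((∑ i ∈ Finset.range n, k ^ i) * f ^ (n - 1) * e ^ (n - 1)) = 0 := by
  have h0 : q ≠ 0 := hq.ne_zero (by omega)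
  set z : A := ∑ i ∈ Finset.range n, (q • k) ^ i with hz
  have hek : e * ∑ i ∈ Finset.range n, k ^ i = z * e := by
    rw [hz, Finset.mul_sum, Finset.sum_mul]
    refine Finset.sum_congr rfl fun i _ => ?_
    rw [pow_skew r.e_k, smul_pow, smul_mul_assoc]
  have hzk : z * (q • k) = z := geom_sum_mul_self (by rw [smul_pow, hq.pow_eq_one, r.k_pow, one_smul])
  have hzk' : z * (q⁻¹ • k ^ (n - 1)) = z := by
    nth_rw 1 [← hzk]
    rw [mul_assoc, smul_mul_smul_comm, mul_inv_cancel₀ h0, r.mul_inv hn, one_smul, mul_one]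
  have hee : e * e ^ (n - 1) = 0 := by
    rw [← pow_succ', Nat.sub_add_cancel (by omega), r.e_pow]
  rw [← mul_assoc, ← mul_assoc, hek, mul_assoc z, r.e_f_pow_pred hn hq, mul_add, add_mul,
    mul_assoc z, mul_assoc _ e, hee, mul_smul_comm,
    ← mul_assoc z (_ - _), mul_sub z, hzk, hzk']
  simp

theorem Relations.f_mul_integral {n : ℕ} {q : ℂ} {k e f : A} (r : Relations n q k e f)
    (hn : 2 ≤ n) :
    f * ((∑ i ∈ Finset.range n, k ^ i) * f ^ (n - 1) * e ^ (n - 1)) = 0 := by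
  have hff : f * f ^ (n - 1) = 0 := by
    rw [← pow_succ', Nat.sub_add_cancel (by omega), r.f_pow]
  rw [← mul_assoc, ← mul_assoc, Finset.mul_sum, Finset.sum_mul]
  rw [Finset.sum_eq_zero, zero_mul]
  intro i _
  rw [pow_skew r.f_k, smul_mul_assoc, mul_assoc, hff, mul_zero, smul_zero]

/-! ### One-sided inverses of a bilinear form -/

/-- The left identity recovers `a` from the functional `β a`, so `β : A → A*` is injective, hence
bijective by dimension. The right identity may then be tested against the functionals `β a`, where
it becomes the left one. -/
theorem IsFrobenius.of_left [FiniteDimensional ℂ A] {β : A →ₗ[ℂ] A →ₗ[ℂ] ℂ} {g : A ⊗[ℂ] A}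
    (assoc : ∀ a b c, β (a * b) c = β a (b * c))
    (left : ∀ a, TensorProduct.lid ℂ A ((β a).rTensor A g) = a) : IsFrobenius β g where
  assoc := assoc
  left := left
  right := by
    let γ : (A →ₗ[ℂ] ℂ) →ₗ[ℂ] A :=
      (TensorProduct.lid ℂ A).toLinearMap ∘ₗ
        (LinearMap.applyₗ g ∘ₗ LinearMap.rTensorHom A)
    have hinj : Function.Injective β := by
      intro a b hab
      rw [← left a, hab, left b]
    have hsurj : Function.Surjective β :=
      (LinearMap.injective_iff_surjective_of_finrank_eq_finrank
        (Subspace.dual_finrank_eq (K := ℂ) (V := A)).symm).1 hinj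
    intro x
    refine (Module.forall_dual_apply_eq_zero_iff ℂ _).1 ?_ |> sub_eq_zero.1
    intro φ
    obtain ⟨a, rfl⟩ := hsurj φ
    rw [map_sub, sub_eq_zero]
    have key : ∀ t : A ⊗[ℂ] A, β a (TensorProduct.rid ℂ A ((β.flip x).lTensor A t)) =
        β (TensorProduct.lid ℂ A ((β a).rTensor A t)) x := by
      intro t
      induction t with
      | zero => simp
      | tmul b c => simp [mul_comm]
      | add s t hs ht => simp only [map_add, hs, ht, LinearMap.add_apply]
    rw [key, left]

end

/-! ### Invariance of `Λ` and the Casimir identity -/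

variable {n : ℕ} {q : ℂ} (hn : 2 ≤ n) (hq : IsPrimitiveRoot q n)

instance : FiniteDimensional ℂ (Uq n q hn hq) := (monomialBasis hn hq).finiteDimensional_of_finite

theorem Lam_eq : Lam hn hq = (∑ i ∈ Finset.range n, K hn hq ^ i) * F hn hq ^ (n - 1) *
    E hn hq ^ (n - 1) := by
  rw [Lam, Finset.sum_mul, Finset.sum_mul]

theorem E_mul_Lam : E hn hq * Lam hn hq = 0 := by
  rw [Lam_eq, (relations hn hq).e_mul_integral hn hq]

theorem F_mul_Lam : F hn hq * Lam hn hq = 0 := by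
  rw [Lam_eq, (relations hn hq).f_mul_integral hn]

theorem K_mul_Lam : K hn hq * Lam hn hq = Lam hn hq := by
  have h : K hn hq * ∑ i ∈ Finset.range n, K hn hq ^ i = ∑ i ∈ Finset.range n, K hn hq ^ i := by
    rw [← (Commute.sum_right _ _ _ fun i _ => (Commute.refl (K hn hq)).pow_right i).eq.symm,
      geom_sum_mul_self (relations hn hq).k_pow]
  rw [Lam_eq, ← mul_assoc, ← mul_assoc, h]

theorem commute_K_of_mem {x : Uq n q hn hq} (hx : x ∈ degreePart hn hq 0) :
    Commute (K hn hq) x := by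
  rw [mem_degreePart, qz_zero hn hq, one_smul] at hx
  rw [commute_iff_eq]
  nth_rw 2 [← hx]
  rw [mul_assoc, (relations hn hq).inv_mul hn, mul_one]

theorem Lam_mem : Lam hn hq ∈ degreePart hn hq 0 := by
  refine Submodule.sum_mem _ fun i hi => ?_
  have h := monomial_mem hn hq
    (⟨i, Finset.mem_range.1 hi⟩, ⟨n - 1, by omega⟩, ⟨n - 1, by omega⟩)
  rwa [sub_self] at h

/-- `Λ` has degree 0 and so commutes with `K`. This right invariance is what drives the lollipop
statement. -/
theorem Lam_mul_K : Lam hn hq * K hn hq = Lam hn hq := by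
  rw [← (commute_K_of_mem hn hq (Lam_mem hn hq)).eq, K_mul_Lam]

/-- The element `∑ Λ₁ ⊗ S Λ₂` of `A ⊗ Aᵒᵖ`. -/
def casimir : Uq n q hn hq ⊗[ℂ] (Uq n q hn hq)ᵐᵒᵖ :=
  Algebra.TensorProduct.map (AlgHom.id ℂ _) (antipodeHom hn hq) (comulHom hn hq (Lam hn hq))

-- Multiplying by `op a` on the left in `Aᵒᵖ` is multiplying by `a` on the right in `A`. For each
-- generator, `Φ x * casimir = Φ (x Λ)` is known because `Λ` is a left integral. The identity passes
-- to products because `x ⊗ 1` and `1 ⊗ op y` commute.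
open MulOpposite Algebra.TensorProduct in
theorem tmul_one_mul_casimir (a : Uq n q hn hq) :
    (a ⊗ₜ[ℂ] 1) * casimir hn hq = (1 ⊗ₜ[ℂ] op a) * casimir hn hq := by
  have r := relations hn hq
  let Φ := (Algebra.TensorProduct.map (AlgHom.id ℂ _) (antipodeHom hn hq)).comp (comulHom hn hq)
  have hΦ : ∀ x y, x * Lam hn hq = y → Φ x * casimir hn hq = Φ y := by
    rintro x _ rfl
    rw [map_mul]
    rfl
  have hmul : ∀ x y : Uq n q hn hq,
      (x ⊗ₜ[ℂ] 1) * casimir hn hq = (1 ⊗ₜ[ℂ] op x) * casimir hn hq →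
      (y ⊗ₜ[ℂ] 1) * casimir hn hq = (1 ⊗ₜ[ℂ] op y) * casimir hn hq →
      ((x * y) ⊗ₜ[ℂ] 1) * casimir hn hq = (1 ⊗ₜ[ℂ] op (x * y)) * casimir hn hq := by
    intro x y hx hy
    have h1 : (x * y) ⊗ₜ[ℂ] (1 : (Uq n q hn hq)ᵐᵒᵖ) = x ⊗ₜ 1 * y ⊗ₜ 1 := by simp
    have h2 : (1 : Uq n q hn hq) ⊗ₜ[ℂ] op (x * y) = 1 ⊗ₜ op y * 1 ⊗ₜ op x := by simp
    have h3 : x ⊗ₜ[ℂ] (1 : (Uq n q hn hq)ᵐᵒᵖ) * 1 ⊗ₜ op y = 1 ⊗ₜ op y * x ⊗ₜ 1 := by simp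
    rw [h1, h2, mul_assoc, hy, ← mul_assoc, h3, mul_assoc, hx, mul_assoc]
  have hK : (K hn hq ⊗ₜ[ℂ] 1) * casimir hn hq = (1 ⊗ₜ[ℂ] op (K hn hq)) * casimir hn hq := by
    have h := hΦ _ _ (K_mul_Lam hn hq)
    have h1 : Φ (K hn hq) = K hn hq ⊗ₜ op (K hn hq ^ (n - 1)) := by
      simp [Φ, comulHom, antipodeHom]
    change _ = casimir hn hq at h
    nth_rw 2 [← h]
    rw [h1, ← mul_assoc, tmul_mul_tmul, ← op_mul, r.inv_mul hn, one_mul, op_one]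
  induction a using induct with
  | h0 c => simp [Algebra.algebraMap_eq_smul_one, ← TensorProduct.smul_tmul']
  | hK => exact hK
  | hE =>
    have h := hΦ _ _ (E_mul_Lam hn hq)
    have h1 : Φ (E hn hq) = 1 ⊗ₜ op (-(E hn hq * K hn hq ^ (n - 1))) +
        E hn hq ⊗ₜ op (K hn hq ^ (n - 1)) := by
      simp [Φ, comulHom, antipodeHom]
    -- The factor `1 ⊗ op K` cancels the `K⁻¹` at the right end of the second leg of both terms of
    -- `Φ E`.
    have h2 : 1 ⊗ₜ[ℂ] op (K hn hq) * Φ (E hn hq) = E hn hq ⊗ₜ 1 - 1 ⊗ₜ op (E hn hq) := by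
      rw [h1, mul_add, tmul_mul_tmul, tmul_mul_tmul, ← op_mul, ← op_mul, neg_mul, mul_assoc,
        r.inv_mul hn, one_mul, one_mul, mul_one, op_neg, TensorProduct.tmul_neg, op_one]
      abel
    rw [← sub_eq_zero, ← sub_mul, ← h2, mul_assoc, h, map_zero, mul_zero]
  | hF =>
    have h := hΦ _ _ (F_mul_Lam hn hq)
    have h1 : Φ (F hn hq) = F hn hq ⊗ₜ 1 + 1 ⊗ₜ op (-(K hn hq * F hn hq)) *
        (K hn hq ^ (n - 1)) ⊗ₜ 1 := by
      simp [Φ, comulHom, antipodeHom]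
    -- In `Φ F` the `K⁻¹` stands in the first leg. The case of `K` carries it over to the second
    -- leg, where it cancels the `K` of `S F = -K F`.
    have hKp : ∀ m : ℕ, ((K hn hq ^ m) ⊗ₜ[ℂ] 1) * casimir hn hq =
        (1 ⊗ₜ[ℂ] op (K hn hq ^ m)) * casimir hn hq := by
      intro m
      induction m with
      | zero => simp
      | succ m ih => rw [pow_succ]; exact hmul _ _ ih hK
    rw [map_zero, h1, add_mul, mul_assoc, hKp, ← mul_assoc, tmul_mul_tmul, ← op_mul, mul_neg,
      ← mul_assoc (K hn hq ^ (n - 1)),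
      r.inv_mul hn, one_mul, one_mul, op_neg, TensorProduct.tmul_neg, neg_mul,
      ← sub_eq_add_neg, sub_eq_zero] at h
    exact h
  | hadd x y hx hy => rw [TensorProduct.add_tmul, op_add, TensorProduct.tmul_add, add_mul, hx, hy,
      add_mul]
  | hmul x y hx hy => exact hmul x y hx hy

theorem standardInverse_eq : standardInverse hn hq =
    (MulOpposite.opLinearEquiv ℂ).symm.toLinearMap.lTensor _ (casimir hn hq) := by
  change (antipodeLin hn hq).lTensor _ (comulHom hn hq (Lam hn hq)) = _
  rw [casimir]
  generalize comulHom hn hq (Lam hn hq) = t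
  induction t with
  | zero => simp
  | tmul a b => simp [antipodeLin]
  | add s t hs ht => simp only [map_add, hs, ht]

/-- The identity `∑ a g¹ ⊗ g² = ∑ g¹ ⊗ g² a`. -/
theorem mulLeft_rTensor_standardInverse (a : Uq n q hn hq) :
    (LinearMap.mulLeft ℂ a).rTensor _ (standardInverse hn hq) =
      (LinearMap.mulRight ℂ a).lTensor _ (standardInverse hn hq) := by
  have h := congrArg ((MulOpposite.opLinearEquiv ℂ).symm.toLinearMap.lTensor _)
    (tmul_one_mul_casimir hn hq a)
  rw [standardInverse_eq]
  convert h using 1 <;> generalize casimir hn hq = t <;>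
  · induction t with
    | zero => simp
    | tmul a b => simp
    | add s t hs ht => simp only [map_add, hs, ht, mul_add]

/-! ### The integral on `ΔΛ` and the Frobenius property -/

/-- Exponents are unrestricted because the coproduct produces powers of `K` such as `i + (n - 1) *
a`, beyond the range of the basis. -/
theorem integral_eq_zero (i : ℕ) {j k : ℕ} (h : ¬(j = n - 1 ∧ k = n - 1)) :
    integral hn hq (K hn hq ^ i * F hn hq ^ j * E hn hq ^ k) = 0 := by
  have r := relations hn hq
  by_cases hj : n ≤ j
  · rw [pow_eq_zero_of_le hj r.f_pow]; simp
  by_cases hk : n ≤ k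
  · rw [pow_eq_zero_of_le hk r.e_pow]; simp
  rw [← Nat.div_add_mod i n, pow_add, pow_mul, r.k_pow, one_pow, one_mul]
  have := integral_monomial hn hq (⟨i % n, Nat.mod_lt _ (by omega)⟩, ⟨j, by omega⟩, ⟨k, by omega⟩)
  rw [if_neg (by tauto)] at this
  exact this

theorem comul_K_pow (i : ℕ) : comulHom hn hq (K hn hq ^ i) =
    (K hn hq ^ i) ⊗ₜ[ℂ] (K hn hq ^ i) := by
  simp [comulHom, Algebra.TensorProduct.tmul_pow]

open Algebra.TensorProduct in
theorem comul_F_pow (m : ℕ) : comulHom hn hq (F hn hq ^ m) =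
    ∑ p ∈ Finset.HasAntidiagonal.antidiagonal m, gauss q p.1 p.2 •
      (((K hn hq ^ (n - 1)) ^ p.1 * F hn hq ^ p.2) ⊗ₜ[ℂ] (F hn hq ^ p.1)) := by
  have r := relations hn hq
  rw [map_pow, comulHom, lift_F, add_comm, skew_binomial (s := q)]
  · simp [tmul_pow]
  · rw [tmul_mul_tmul, tmul_mul_tmul, r.f_inv hn hq, one_mul, mul_one, TensorProduct.smul_tmul']

open Algebra.TensorProduct in
theorem comul_E_pow (m : ℕ) : comulHom hn hq (E hn hq ^ m) =
    ∑ p ∈ Finset.HasAntidiagonal.antidiagonal m, gauss q p.1 p.2 •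
      ((E hn hq ^ p.1) ⊗ₜ[ℂ] (K hn hq ^ p.1 * E hn hq ^ p.2)) := by
  have r := relations hn hq
  rw [map_pow, comulHom, lift_E, add_comm, skew_binomial (s := q)]
  · simp [tmul_pow]
  · rw [tmul_mul_tmul, tmul_mul_tmul, r.e_k, one_mul, mul_one, TensorProduct.tmul_smul]

/-- The first legs are multiples of `K ^ * F ^ b E ^ c` with `b, c ≤ n - 1`, and `∫` sees only `b =
c = n - 1`. This keeps just `F ^ (n - 1) ⊗ 1` from the powers of `F` and `E ^ (n - 1) ⊗ K ^ (n - 1)`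
from those of `E`. -/
theorem integral_comul_top (i : ℕ) : TensorProduct.lid ℂ _ ((integral hn hq).rTensor _
    (comulHom hn hq (K hn hq ^ i * F hn hq ^ (n - 1) * E hn hq ^ (n - 1)))) =
    integral hn hq (K hn hq ^ i * F hn hq ^ (n - 1) * E hn hq ^ (n - 1)) •
      (K hn hq ^ i * K hn hq ^ (n - 1)) := by
  rw [map_mul (comulHom hn hq), map_mul (comulHom hn hq), comul_K_pow, comul_F_pow, comul_E_pow,
    Finset.mul_sum _ _ (_ ⊗ₜ[ℂ] _), Finset.sum_mul_sum,
    map_sum, map_sum, Finset.sum_eq_single (0, n - 1), map_sum, map_sum,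
    Finset.sum_eq_single (n - 1, 0)]
  · simp [gauss_zero_left, gauss_zero_right]
  · rintro ⟨c, d⟩ hp hne
    rw [Finset.HasAntidiagonal.mem_antidiagonal] at hp
    have := integral_eq_zero hn hq i (j := n - 1) (k := c) (by
      rintro ⟨-, rfl⟩; exact hne (by simp only [Prod.mk.injEq, true_and]; simp only at hp; omega))
    simp [this]
  · simp
  · rintro ⟨a, b⟩ hp hne
    rw [Finset.HasAntidiagonal.mem_antidiagonal] at hp
    rw [map_sum, map_sum]
    refine Finset.sum_eq_zero ?_
    rintro ⟨c, d⟩ -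
    have := integral_eq_zero hn hq (i + (n - 1) * a) (j := b) (k := c) (by
      rintro ⟨rfl, -⟩; exact hne (by simp only [Prod.mk.injEq, and_true]; simp only at hp; omega))
    rw [pow_add, pow_mul, mul_assoc (K hn hq ^ i)] at this
    simp [this]
  · simp

/-- Only the summand `i = 1` of `Λ` has nonzero integral, and it contributes `K K⁻¹`. -/
theorem integral_comul_Lam :
    TensorProduct.lid ℂ _ ((integral hn hq).rTensor _ (comulHom hn hq (Lam hn hq))) = 1 := by
  have h : ∀ i ∈ Finset.range n,
      integral hn hq (K hn hq ^ i * F hn hq ^ (n - 1) * E hn hq ^ (n - 1)) =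
      if i = 1 then 1 else 0 := by
    intro i hi
    have := integral_monomial hn hq
      (⟨i, Finset.mem_range.1 hi⟩, ⟨n - 1, by omega⟩, ⟨n - 1, by omega⟩)
    simpa [monomial] using this
  rw [Lam, map_sum, map_sum, map_sum, Finset.sum_congr rfl fun i hi => by
    rw [integral_comul_top, h i hi]]
  rw [Finset.sum_eq_single 1 (by intro i _ hi; simp [hi]) (by simp; omega)]
  simpa using (relations hn hq).mul_inv hn

theorem integral_standardInverse :
    TensorProduct.lid ℂ _ ((integral hn hq).rTensor _ (standardInverse hn hq)) = 1 := by
  -- The antipode acts on the second leg and `∫` on the first, so the value is `S 1`.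
  rw [← antipodeLin_one hn hq, ← integral_comul_Lam hn hq]
  change TensorProduct.lid ℂ _ ((integral hn hq).rTensor _
    ((antipodeLin hn hq).lTensor _ (comulHom hn hq (Lam hn hq)))) = _
  generalize comulHom hn hq (Lam hn hq) = t
  induction t with
  | zero => simp
  | tmul a b => simp
  | add s t hs ht => simp only [map_add, hs, ht]

theorem isFrobenius_twist (u : (Uq n q hn hq)ˣ) :
    IsFrobenius (twistForm (standardForm hn hq) u) (twistInverse (standardInverse hn hq) u) := by
  refine IsFrobenius.of_left ?_ ?_
  · intro a b c
    simp [twistForm, standardForm, mul_assoc]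
  · intro a
    -- The factor `u⁻¹` is pulled out on the left, and `u a` is put in front of the first leg, where
    -- the Casimir identity can move it to the right end of the second.
    have key : ∀ t : Uq n q hn hq ⊗[ℂ] Uq n q hn hq,
        TensorProduct.lid ℂ _ ((twistForm (standardForm hn hq) u a).rTensor _ (twistInverse t u)) =
        ↑u⁻¹ * TensorProduct.lid ℂ _ ((integral hn hq).rTensor _
          ((LinearMap.mulLeft ℂ (↑u * a)).rTensor _ t)) := by
      intro t
      induction t with
      | zero => simp [twistInverse]
      | tmul b c => simp [twistInverse, twistForm, standardForm, mul_assoc]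
      | add s t hs ht =>
        simp only [twistInverse, map_add, mul_add] at hs ht ⊢
        rw [hs, ht]
    have key2 : ∀ (b : Uq n q hn hq) (t : Uq n q hn hq ⊗[ℂ] Uq n q hn hq),
        TensorProduct.lid ℂ _ ((integral hn hq).rTensor _
          ((LinearMap.mulRight ℂ b).lTensor _ t)) =
        TensorProduct.lid ℂ _ ((integral hn hq).rTensor _ t) * b := by
      intro b t
      induction t with
      | zero => simp
      | tmul c d => simp
      | add s t hs ht => simp only [map_add, add_mul, hs, ht]
    rw [key, mulLeft_rTensor_standardInverse, key2, integral_standardInverse, one_mul,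
      Units.inv_mul_cancel_left]

/-! ### Commutativity of the degree-zero part -/

/-- The subalgebra generated by `K` and `F E`. -/
def cartan : Subalgebra ℂ (Uq n q hn hq) :=
  Algebra.adjoin ℂ {K hn hq, F hn hq * E hn hq}

theorem K_mem_cartan : K hn hq ∈ cartan hn hq := Algebra.subset_adjoin (by simp)

theorem FE_mem_cartan : F hn hq * E hn hq ∈ cartan hn hq := Algebra.subset_adjoin (by simp)

theorem commute_of_mem_cartan {x y : Uq n q hn hq} (hx : x ∈ cartan hn hq)
    (hy : y ∈ cartan hn hq) : Commute x y := by
  have h : Commute (K hn hq) (F hn hq * E hn hq) := by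
    apply commute_K_of_mem
    have := SetLike.mul_mem_graded (F_mem hn hq) (E_mem hn hq)
    rwa [add_neg_cancel] at this
  have hgen : ∀ a ∈ ({K hn hq, F hn hq * E hn hq} : Set (Uq n q hn hq)),
      ∀ b ∈ ({K hn hq, F hn hq * E hn hq} : Set (Uq n q hn hq)), Commute b a := by
    rintro a (rfl | rfl) b (rfl | rfl)
    · exact Commute.refl _
    · exact h.symm
    · exact h
    · exact Commute.refl _
  exact Algebra.commute_of_mem_adjoin_of_forall_mem_commute hy fun b hb =>
    (Algebra.commute_of_mem_adjoin_of_forall_mem_commute hx fun a ha => hgen a ha b hb).symm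

/-- This lets `F ^ (j + 1) E ^ (j + 1) = F (F ^ j E ^ j) E` be rewritten as `y (F E)` with `y` in
the subalgebra. -/
theorem exists_F_mul_of_mem_cartan {x : Uq n q hn hq} (hx : x ∈ cartan hn hq) :
    ∃ y ∈ cartan hn hq, F hn hq * x = y * F hn hq := by
  have r := relations hn hq
  have hK := K_mem_cartan hn hq
  induction hx using Algebra.adjoin_induction with
  | mem x hx =>
    obtain rfl | rfl := hx
    · exact ⟨q⁻¹ • K hn hq, Subalgebra.smul_mem _ hK _, by rw [r.f_k, smul_mul_assoc]⟩
    -- The witness comes from writing `F (F E) = F (E F - [E, F])` and moving `F` to the right past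
    -- the `K`-terms of the commutator.
    · refine ⟨F hn hq * E hn hq - (q - q⁻¹)⁻¹ • (q⁻¹ • K hn hq - q • K hn hq ^ (n - 1)),
        sub_mem (FE_mem_cartan hn hq) (Subalgebra.smul_mem _ (sub_mem
          (Subalgebra.smul_mem _ hK _) (Subalgebra.smul_mem _ (pow_mem hK _) _)) _), ?_⟩
      have h1 : F hn hq * E hn hq = E hn hq * F hn hq -
          (q - q⁻¹)⁻¹ • (K hn hq - K hn hq ^ (n - 1)) := by rw [← r.e_f]; abel
      nth_rw 1 [h1]
      rw [mul_sub, mul_smul_comm, mul_sub, r.f_k, r.f_inv hn hq, sub_mul, smul_mul_assoc, sub_mul,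
        smul_mul_assoc, smul_mul_assoc, mul_assoc]
  | algebraMap c => exact ⟨algebraMap ℂ _ c, Subalgebra.algebraMap_mem _ _,
      (Algebra.commutes _ _).symm⟩
  | add x y _ _ hx hy =>
    obtain ⟨x', hx', hx⟩ := hx
    obtain ⟨y', hy', hy⟩ := hy
    exact ⟨x' + y', add_mem hx' hy', by rw [mul_add, hx, hy, add_mul]⟩
  | mul x y _ _ hx hy =>
    obtain ⟨x', hx', hx⟩ := hx
    obtain ⟨y', hy', hy⟩ := hy
    exact ⟨x' * y', mul_mem hx' hy', by rw [← mul_assoc, hx, mul_assoc, hy, mul_assoc]⟩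

theorem F_pow_mul_E_pow_mem_cartan (j : ℕ) : F hn hq ^ j * E hn hq ^ j ∈ cartan hn hq := by
  induction j with
  | zero => simp
  | succ j ih =>
    obtain ⟨y, hy, h⟩ := exists_F_mul_of_mem_cartan hn hq ih
    rw [pow_succ', pow_succ, mul_assoc, ← mul_assoc (F hn hq ^ j), ← mul_assoc, h, mul_assoc]
    exact mul_mem hy (FE_mem_cartan hn hq)

/-- An element of degree 0 equals its own projection, and the projection can be computed on the
spanning monomials. -/
theorem degreePart_zero_le_cartan {x : Uq n q hn hq} (hx : x ∈ degreePart hn hq 0) :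
    x ∈ cartan hn hq := by
  have h1 : ∀ y : Uq n q hn hq, GradedRing.proj (degreePart hn hq) 0 y ∈ cartan hn hq := by
    intro y
    have hy := monomial_span hn hq (Submodule.mem_top : y ∈ ⊤)
    induction hy using Submodule.span_induction with
    | mem y hy =>
      obtain ⟨p, rfl⟩ := hy
      have hp := monomial_mem hn hq p
      rw [GradedRing.proj_apply]
      by_cases h : p.2.1 = p.2.2
      · rw [h, sub_self] at hp
        rw [DirectSum.decompose_of_mem_same _ hp, monomial, h, mul_assoc]
        exact mul_mem (pow_mem (K_mem_cartan hn hq) _) (F_pow_mul_E_pow_mem_cartan hn hq _)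
      · rw [DirectSum.decompose_of_mem_ne _ hp]
        · exact zero_mem _
        -- Degrees are only residues modulo `n`, but both exponents are below `n`, so congruent
        -- exponents are equal.
        · intro h2
          rw [sub_eq_zero, ZMod.natCast_eq_natCast_iff', Nat.mod_eq_of_lt p.2.1.2,
            Nat.mod_eq_of_lt p.2.2.2] at h2
          exact h (Fin.ext h2)
    | zero => rw [map_zero]; exact zero_mem _
    | add x y _ _ hx hy => rw [map_add]; exact add_mem hx hy
    | smul c x _ hx =>
      rw [GradedRing.proj_apply, DirectSum.decompose_smul]
      exact Subalgebra.smul_mem _ hx c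
  have := h1 x
  rwa [GradedRing.proj_apply, DirectSum.decompose_of_mem_same _ hx] at this

/-! ### The lollipop as a function of `u⁻¹` -/

/-- The map `w ↦ ∑ Λ₁ w S Λ₂`. -/
def adLam : Uq n q hn hq →ₗ[ℂ] Uq n q hn hq :=
  LinearMap.mul' ℂ _ ∘ₗ LinearMap.applyₗ (standardInverse hn hq) ∘ₗ LinearMap.lTensorHom _ ∘ₗ
    LinearMap.mul ℂ _

theorem twistedLollipop_eq (u : (Uq n q hn hq)ˣ) :
    twistedLollipop hn hq u = adLam hn hq (↑u⁻¹ : Uq n q hn hq) := rfl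

/-- Absorbing `K` into `Λ₁` and `K⁻¹ = S K` into `SΛ₂` replaces `ΔΛ` by `ΔΛ · (K ⊗ K) = Δ(ΛK) = ΔΛ`.
-/
theorem adLam_conjK (w : Uq n q hn hq) : adLam hn hq (conjK hn hq w) = adLam hn hq w := by
  have key : ∀ t : Uq n q hn hq ⊗[ℂ] Uq n q hn hq,
      LinearMap.mul' ℂ _ ((LinearMap.mul ℂ _ (conjK hn hq w)).lTensor _
        ((antipodeLin hn hq).lTensor _ t)) =
      LinearMap.mul' ℂ _ ((LinearMap.mul ℂ _ w).lTensor _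
        ((antipodeLin hn hq).lTensor _ (t * K hn hq ⊗ₜ K hn hq))) := by
    intro t
    induction t with
    | zero => simp
    | tmul a b => simp [conjK, antipodeLin_mul, antipodeLin_K, mul_assoc]
    | add s t hs ht => simp only [map_add, add_mul, hs, ht]
  have hL : comulHom hn hq (Lam hn hq) * K hn hq ⊗ₜ K hn hq = comulHom hn hq (Lam hn hq) := by
    have h := congrArg (comulHom hn hq) (Lam_mul_K hn hq)
    rw [map_mul] at h
    simpa [comulHom] using h
  have h := key (comulHom hn hq (Lam hn hq))
  rw [hL] at h
  exact h

/-- By conjugation invariance `q ^ d` fixes the value at `w`, and `q ^ d ≠ 1` because `q` is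
primitive. -/
theorem adLam_of_mem {d : ZMod n} (hd : d ≠ 0) {w : Uq n q hn hq} (hw : w ∈ degreePart hn hq d) :
    adLam hn hq w = 0 := by
  have h := adLam_conjK hn hq w
  rw [Module.End.mem_eigenspace_iff.1 hw, map_smul] at h
  have h1 : (qz n q d - 1) • adLam hn hq w = 0 := by rw [sub_smul, h, one_smul, sub_self]
  refine (smul_eq_zero.1 h1).resolve_left fun h2 => hd (qz_injective hn hq ?_)
  rw [sub_eq_zero.1 h2, qz_zero hn hq]

theorem adLam_proj (w : Uq n q hn hq) :
    adLam hn hq (GradedRing.proj (degreePart hn hq) 0 w) = adLam hn hq w := by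
  induction w using DirectSum.Decomposition.inductionOn (degreePart hn hq) with
  | zero => simp
  | @homogeneous d m =>
    rw [GradedRing.proj_apply]
    by_cases hd : d = 0
    · subst hd
      rw [DirectSum.decompose_of_mem_same _ m.2]
    · rw [DirectSum.decompose_of_mem_ne _ m.2 hd, map_zero, adLam_of_mem hn hq hd m.2]
  | add x y hx hy => rw [map_add, map_add, map_add, hx, hy]

end SmallQuantum

end

theorem mainTheorem9 (n : ℕ) (q : ℂ) (hn : 2 ≤ n) (hq : IsPrimitiveRoot q n) :
    (∀ u : (Uq n q hn hq)ˣ,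
      IsFrobenius (twistForm (standardForm hn hq) u) (twistInverse (standardInverse hn hq) u)) ∧
    (∀ x ∈ degreePart hn hq 0, ∀ y ∈ degreePart hn hq 0, x * y = y * x) ∧
    (∀ u v : (Uq n q hn hq)ˣ,
      GradedRing.proj (degreePart hn hq) 0 (↑u⁻¹ : Uq n q hn hq) =
          GradedRing.proj (degreePart hn hq) 0 (↑v⁻¹ : Uq n q hn hq) →
        twistedLollipop hn hq u = twistedLollipop hn hq v) := by
  refine ⟨isFrobenius_twist hn hq, fun x hx y hy => ?_, fun u v h => ?_⟩
  · exact commute_of_mem_cartan hn hq (degreePart_zero_le_cartan hn hq hx)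
      (degreePart_zero_le_cartan hn hq hy)
  · rw [twistedLollipop_eq, twistedLollipop_eq, ← adLam_proj, h, adLam_proj]
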